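/- Let $p$ be a prime, $r\ge 1$, $R=\mathbb{Z}_{p^r}$, and let $R((D))$ be the ring of formal Laurent series over $R$. A free convolutional code of length $n$ and rank $k$ over $R$ is a submodule $\mathcal{C}=\{u(D)G(D): u(D)\in R((D))^k\}$ of $R((D))^n$, where $G(D)\in R[D]^{k\times n}$ has full row rank, i.e. its rows are linearly independent over $R((D))$; every such $G$ is called an encoder of $\mathcal{C}$. The weight $\mathrm{wt}(u)$ of a vector of Laurent series is the total number of its nonzero coefficients. An encoder $G$ is non-catastrophic if for all $u\in R((D))^k$ one has $\mathrm{wt}(uG)<\infty\iff \mathrm{wt}(u)<\infty$, and catastrophic otherwise; $\mathcal{C}$ is non-catastrophic if it has a non-catastrophic encoder. An encoder $G$ of $\mathcal{C}$ is a reduced internal degree matrix (RIDM) if the maximum of the degrees of its $k\times k$ minors is minimal among all encoders of $\mathcal{C}$; such encoders exist. For an RIDM $G$ let $\Delta_p(G)\in\mathbb{F}_p[D]$ be the monic greatest common divisor of the $k\times k$ minors of the reduction $\overline{G}(D)\in\mathbb{F}_p[D]^{k\times n}$ of $G$ modulo $p$. Theorem. Let $\mathcal{C}$ be a free convolutional code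 over $\mathbb{Z}_{p^r}$. The polynomial $\Delta_p(G)$ is the same for all RIDM encoders $G$ of $\mathcal{C}$; denote it by $\Delta_p(\mathcal{C})$ (the Residual Structural Polynomial of $\mathcal{C}$). Then $\mathcal{C}$ is non-catastrophic if and only if $\Delta_p(\mathcal{C})=D^s$ for some integer $s\ge 0$. Consequently, if $\Delta_p(\mathcal{C})$ has an irreducible factor $Q\in\mathbb{F}_p[D]$ that is not a scalar multiple of $D$, then every encoder of $\mathcal{C}$ is catastrophic. -/

import Mathlib

noncomputable section

namespace ConvCode

open Polynomial

section General

variable {R : Type*} [CommRing R] {k n : ℕ}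

/-- The inclusion of the polynomial ring `R[D]` into the ring `R((D))` of formal Laurent series. -/
def toLaurent (R : Type*) [CommRing R] : R[X] →+* LaurentSeries R :=
  (HahnSeries.ofPowerSeries ℤ R).comp Polynomial.coeToPowerSeries.ringHom

/-- A polynomial matrix, viewed as a matrix over `R((D))`. -/
def laurentMatrix (G : Matrix (Fin k) (Fin n) R[X]) :
    Matrix (Fin k) (Fin n) (LaurentSeries R) :=
  G.map (toLaurent R)

/-- The code generated by `G`: all `u(D) G(D)` with `u(D) ∈ R((D))^k`. -/
def code (G : Matrix (Fin k) (Fin n) R[X]) :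
    Submodule (LaurentSeries R) (Fin n → LaurentSeries R) :=
  LinearMap.range (laurentMatrix G).vecMulLinear

/-- Full row rank: the rows are linearly independent over `R((D))`, so that they form a basis
of the code they generate. -/
def FullRowRank (G : Matrix (Fin k) (Fin n) R[X]) : Prop :=
  LinearIndependent (LaurentSeries R) (laurentMatrix G).row

/-- `G` is a generator matrix (encoder) with `k` rows of the code `C`. -/
def IsEncoder (C : Submodule (LaurentSeries R) (Fin n → LaurentSeries R))
    (G : Matrix (Fin k) (Fin n) R[X]) : Prop :=
  FullRowRank G ∧ code G = C

/-- `C` is a free convolutional code of rank `k` (and length `n`). -/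
def IsFreeConvCode (k : ℕ)
    (C : Submodule (LaurentSeries R) (Fin n → LaurentSeries R)) : Prop :=
  ∃ G : Matrix (Fin k) (Fin n) R[X], IsEncoder C G

/-- The Hamming weight of a vector of Laurent series: the total number of nonzero coefficients,
possibly infinite. -/
def wt {l : ℕ} (u : Fin l → LaurentSeries R) : ℕ∞ :=
  ∑ i, (Function.support (u i).coeff).encard

/-- A polynomial matrix is non-catastrophic if `u G` has finite weight exactly when `u` has. -/
def NonCatastrophic (G : Matrix (Fin k) (Fin n) R[X]) : Prop :=
  ∀ u : Fin k → LaurentSeries R,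
    wt (Matrix.vecMul u (laurentMatrix G)) < ⊤ ↔ wt u < ⊤

/-- A code of rank `k` is non-catastrophic if it has a non-catastrophic polynomial encoder. -/
def NonCatastrophicCode (k : ℕ)
    (C : Submodule (LaurentSeries R) (Fin n → LaurentSeries R)) : Prop :=
  ∃ G : Matrix (Fin k) (Fin n) R[X], IsEncoder C G ∧ NonCatastrophic G

/-- The `k × k` minor of `G` on the columns selected by `e`. -/
def minor (G : Matrix (Fin k) (Fin n) R[X]) (e : Fin k ↪o Fin n) : R[X] :=
  (G.submatrix id e).det

/-- The internal degree: the maximum of the degrees of the `k × k` minors. -/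
def intdeg (G : Matrix (Fin k) (Fin n) R[X]) : ℕ :=
  Finset.univ.sup fun e : Fin k ↪o Fin n => (minor G e).natDegree

/-- Reduced internal degree matrix: the internal degree is minimal among all polynomial generator
matrices of the same code. -/
def IsRIDM (G : Matrix (Fin k) (Fin n) R[X]) : Prop :=
  FullRowRank G ∧
    ∀ G' : Matrix (Fin k) (Fin n) R[X], IsEncoder (code G) G' → intdeg G ≤ intdeg G'

/-- Every free convolutional code has an encoder that is a RIDM. -/
theorem IsFreeConvCode.exists_ridm
    {C : Submodule (LaurentSeries R) (Fin n → LaurentSeries R)} (hC : IsFreeConvCode k C) :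
    ∃ G : Matrix (Fin k) (Fin n) R[X], IsRIDM G ∧ code G = C := by
  classical
  have hex : ∃ d, ∃ G : Matrix (Fin k) (Fin n) R[X], IsEncoder C G ∧ intdeg G = d :=
    hC.elim fun G hG => ⟨_, G, hG, rfl⟩
  obtain ⟨G, hG, hd⟩ := Nat.find_spec hex
  refine ⟨G, ⟨hG.1, fun G' hG' => ?_⟩, hG.2⟩
  rw [hG.2] at hG'
  rw [hd]
  exact Nat.find_min' hex ⟨G', hG', rfl⟩

/-- The monic greatest common divisor of the `k × k` minors of a matrix over `F[D]`, for a
field `F` (it is `0` if all minors vanish). -/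
def minorsGCD {F : Type*} [Field F] [DecidableEq F] (G : Matrix (Fin k) (Fin n) F[X]) : F[X] :=
  letI : NormalizedGCDMonoid F[X] := UniqueFactorizationMonoid.toNormalizedGCDMonoid F[X]
  Finset.univ.gcd (minor G)

end General

section Residual

variable {p r k n : ℕ} [Fact p.Prime] [NeZero r]

/-- Coefficientwise reduction modulo `p` of a polynomial matrix over `ℤ/p^r`. -/
def residue (G : Matrix (Fin k) (Fin n) (ZMod (p ^ r))[X]) :
    Matrix (Fin k) (Fin n) (ZMod p)[X] :=
  G.map (Polynomial.mapRingHom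
    (ZMod.castHom (dvd_pow_self p (NeZero.ne r)) (ZMod p)))

/-- `Δ_p(G)`: the monic gcd of the `k × k` minors of the reduction of `G` modulo `p`. -/
def matrixDelta (G : Matrix (Fin k) (Fin n) (ZMod (p ^ r))[X]) : (ZMod p)[X] :=
  minorsGCD (residue G)

/-- The Residual Structural Polynomial `Δ_p(C)` of a free convolutional code `C`: the polynomial
`Δ_p(G)` of a RIDM encoder `G` of `C`. -/
def codeDelta {C : Submodule (LaurentSeries (ZMod (p ^ r)))
      (Fin n → LaurentSeries (ZMod (p ^ r)))}
    (hC : IsFreeConvCode k C) : (ZMod p)[X] :=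
  matrixDelta hC.exists_ridm.choose

end Residual

end ConvCode

end

/-! Reducing the polynomial words of `C` modulo `p` gives a submodule of `F_p[D]^n` of rank `k` over
a PID, hence free. Lifting a basis gives an encoder `E` (`IsReduction.exists_basic`), and the
reduction of every encoder is `T` times that of `E` for some square polynomial matrix `T`. Hence
`Δ_p(E)` divides `Δ_p(G)` for every encoder `G`.

For a RIDM, `det T` is a unit, so `Δ_p(G) = Δ_p(E)` (`IsReduction.isUnit_det_of_isRIDM`). The minors
of two encoders are proportional, and Weierstrass preparation makes the proportionality factors
monic. After a unit rescaling of the minors of `E`, each nonzero minor of `G` exceeds its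
counterpart in degree by exactly `deg (det T)`, which minimality forces to be zero.

If an irreducible `Q`, not associated to `D`, divides `Δ_p(E)`, it divides all reduced minors of
every encoder `G`. Then some `a`, not divisible by `Q`, has reduced product `aG` divisible by `Q`,
and `p^(r-1)` times a lift of `a/Q` is an input of infinite weight with output of finite weight. If
instead `Δ_p(E) = D^s`, Bézout, adjugates and nilpotency of `p` give a polynomial `H` with `E H =
D^N`, so `E` is non-catastrophic. -/

noncomputable section

namespace ConvCode

open Polynomial

/-! ### Linear independence of rows and nonvanishing minors. -/

section FieldMinors

theorem exists_minor_ne_zero_of_field {K : Type*} [Field K] {k n : ℕ}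
    (A : Matrix (Fin k) (Fin n) K) (hA : LinearIndependent K A.row) :
    ∃ e : Fin k ↪o Fin n, (A.submatrix id e).det ≠ 0 := by
  classical
  have hrank : A.rank = k := by simpa using hA.rank_matrix
  -- A basis of the column space chosen among the columns has `k` elements; listed in increasing
  -- order, these columns form an invertible block.
  obtain ⟨κ, a, ha, hspan, hli⟩ := exists_linearIndependent' K A.col
  have : Finite κ := Finite.of_injective a ha
  have : Fintype κ := Fintype.ofFinite κ
  have hcard : Fintype.card κ = k := by
    rw [← finrank_span_eq_card hli, hspan, ← A.rank_eq_finrank_span_cols, hrank]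
  let S : Finset (Fin n) := Finset.univ.image a
  have hS : S.card = k := by
    rw [Finset.card_image_of_injective _ ha, Finset.card_univ, hcard]
  let e := S.orderEmbOfFin hS
  have hmem : ∀ i, ∃ x, a x = e i := fun i => by
    obtain ⟨x, -, hx⟩ := Finset.mem_image.1 (S.orderEmbOfFin_mem hS i)
    exact ⟨x, hx⟩
  choose g hg using hmem
  have hginj : Function.Injective g := fun i j hij => e.injective (by rw [← hg, ← hg, hij])
  refine ⟨e, ?_⟩
  have hli' : LinearIndependent K (A.submatrix id e).col := by
    have heq : (A.submatrix id e).col = (A.col ∘ a) ∘ g := by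
      ext i j
      exact congrArg (A j) (hg i).symm
    rw [heq]
    exact hli.comp g hginj
  rw [Matrix.linearIndependent_cols_iff_isUnit, Matrix.isUnit_iff_isUnit_det] at hli'
  exact hli'.ne_zero

theorem exists_det_ne_zero_of_domain {A : Type*} [CommRing A] [IsDomain A] {k n : ℕ}
    (M : Matrix (Fin k) (Fin n) A) (hM : LinearIndependent A M.row) :
    ∃ e : Fin k ↪o Fin n, (M.submatrix id e).det ≠ 0 := by
  let f := algebraMap A (FractionRing A)
  have hli : LinearIndependent (FractionRing A) (M.map f).row := by
    rw [← LinearIndependent.iff_fractionRing (R := A)]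
    have hinj : Function.Injective
        ((Algebra.linearMap A (FractionRing A)).compLeft (Fin n)) := by
      intro x y hxy
      ext i
      exact IsFractionRing.injective A (FractionRing A) (congrFun hxy i)
    exact hM.map' _ (LinearMap.ker_eq_bot.2 hinj)
  obtain ⟨e, he⟩ := exists_minor_ne_zero_of_field _ hli
  refine ⟨e, fun h0 => he ?_⟩
  have : (M.map f).submatrix id e = f.mapMatrix (M.submatrix id e) := rfl
  rw [this, ← RingHom.map_det, h0, map_zero]

end FieldMinors

/-! ### Reduction modulo a nilpotent, Weierstrass preparation, and units among Laurent series. -/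

section Residue

variable {R F : Type*} [CommRing R] [Field F]

/-- `π` is the reduction of `R` modulo a nilpotent element `ϖ`, and `q` generates the
annihilator of `ϖ`, in the sense that `q` kills exactly the kernel of `π`. -/
structure IsReduction (π : R →+* F) (ϖ q : R) : Prop where
  surjective : Function.Surjective π
  map_eq_zero_iff : ∀ x, π x = 0 ↔ ϖ ∣ x
  isNilpotent : IsNilpotent ϖ
  mul_eq_zero_iff : ∀ x, q * x = 0 ↔ π x = 0

variable {π : R →+* F} {ϖ q : R}

/-- A lift of the inverse gives a product differing from 1 by a nilpotent, and such a product is a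
unit. -/
theorem isUnit_of_isUnit_map {A B : Type*} [CommRing A] [CommRing B] {f : A →+* B}
    (hf : Function.Surjective f) (hker : ∀ x, f x = 0 → IsNilpotent x) {x : A}
    (hx : IsUnit (f x)) : IsUnit x := by
  obtain ⟨b, hb⟩ := hx.exists_right_inv
  obtain ⟨y, rfl⟩ := hf b
  have h : IsNilpotent (x * y - 1) := hker _ (by rw [map_sub, map_mul, hb, map_one, sub_self])
  have h' := h.isUnit_add_one
  rw [sub_add_cancel] at h'
  exact isUnit_of_mul_isUnit_left h'

theorem IsReduction.isUnit (h : IsReduction π ϖ q) {x : R} (hx : π x ≠ 0) : IsUnit x := by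
  refine isUnit_of_isUnit_map h.surjective (fun y hy => ?_) hx.isUnit
  obtain ⟨z, rfl⟩ := (h.map_eq_zero_iff y).1 hy
  exact (Commute.all _ _).isNilpotent_mul_right h.isNilpotent

/-- Weierstrass preparation for polynomials over a ring with nilpotent maximal ideal. -/
theorem IsReduction.exists_isUnit_mul_monic (h : IsReduction π ϖ q) (f : R[X])
    (hf : f.map π ≠ 0) :
    ∃ u g : R[X], IsUnit u ∧ u * f = g ∧ g.Monic ∧ g.natDegree = (f.map π).natDegree := by
  have key : ∀ j : ℕ, ∃ u g s : R[X], IsUnit u ∧ u * f = g + C ϖ ^ (j + 1) * s ∧ g.Monic ∧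
      g.natDegree = (f.map π).natDegree := by
    intro j
    induction j with
    | zero =>
      set c := (f.map π).leadingCoeff with hc
      have hc0 : c ≠ 0 := leadingCoeff_ne_zero.2 hf
      obtain ⟨b, hb⟩ := h.surjective c⁻¹
      have hbu : IsUnit b := h.isUnit (by rw [hb]; exact inv_ne_zero hc0)
      have hmonic : (C c⁻¹ * f.map π).Monic := by
        rw [Monic, leadingCoeff_mul, leadingCoeff_C, ← hc, inv_mul_cancel₀ hc0]
      have hlift : C c⁻¹ * f.map π ∈ lifts π := by
        rw [← hb]
        exact ⟨C b * f, by simp⟩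
      obtain ⟨g, hg, hdeg, hgm⟩ := lifts_and_natDegree_eq_and_monic hlift hmonic
      have hdvd : C ϖ ∣ C b * f - g := by
        rw [C_dvd_iff_dvd_coeff]
        intro i
        rw [← h.map_eq_zero_iff, ← coeff_map]
        simp [hg, hb]
      obtain ⟨s, hs⟩ := hdvd
      refine ⟨C b, g, s, hbu.map C, ?_, hgm, ?_⟩
      · rw [zero_add, pow_one, ← hs]; ring
      · rw [hdeg, natDegree_C_mul (inv_ne_zero hc0)]
    | succ j ih =>
      obtain ⟨u, g, s, hu, hug, hgm, hgd⟩ := ih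
      have hR : Nontrivial R := π.domain_nontrivial
      have hs := modByMonic_add_div s g
      set t := s %ₘ g
      set v := s /ₘ g
      have hdeg : (C ϖ ^ (j + 1) * t).degree < g.degree := by
        rw [← C_pow, C_mul']
        exact (degree_smul_le _ _).trans_lt (degree_modByMonic_lt s hgm)
      have hnil : IsNilpotent (C ϖ ^ (j + 1) * v) := by
        refine (Commute.all _ _).isNilpotent_mul_right ?_
        exact (h.isNilpotent.map C).pow_succ j
      -- With error `ε s`, `ε = ϖ^(j+1)` and `s = t + g v`, the factor `1 - ε v` cancels `ε g v`.
      -- The term `ε t` has lower degree than `g` and is absorbed into it; what remains is a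
      -- multiple of `ε²`, hence of `ϖ^(j+2)`.
      refine ⟨(1 - C ϖ ^ (j + 1) * v) * u, g + C ϖ ^ (j + 1) * t,
        - (C ϖ ^ j * (v ^ 2 * g + v * t)), hnil.isUnit_one_sub.mul hu, ?_,
        hgm.add_of_left hdeg, ?_⟩
      · rw [mul_assoc, hug, ← hs]; ring
      · rw [natDegree_add_eq_left_of_degree_lt hdeg, hgd]
  obtain ⟨N, hN⟩ := h.isNilpotent
  obtain ⟨u, g, s, hu, hug, hgm, hgd⟩ := key N
  refine ⟨u, g, hu, ?_, hgm, hgd⟩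
  rw [hug, ← C_pow, pow_succ, hN]
  simp

/-- Coefficientwise application of a ring homomorphism to Laurent series. -/
def laurentMap (π : R →+* F) : LaurentSeries R →+* LaurentSeries F where
  toFun x := x.map π
  map_one' := by ext i; by_cases hi : i = 0 <;> simp [HahnSeries.coeff_one, hi]
  map_zero' := by ext; simp
  map_add' x y := by ext; simp
  map_mul' x y := HahnSeries.map_mul (π : R →ₙ+* F)

@[simp]
theorem coeff_laurentMap (π : R →+* F) (x : LaurentSeries R) (i : ℤ) :
    (laurentMap π x).coeff i = π (x.coeff i) := rfl

theorem coeff_toLaurent {A : Type*} [CommRing A] (f : A[X]) (i : ℤ) :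
    (toLaurent A f).coeff i = if i < 0 then 0 else f.coeff i.natAbs := by
  change ((f : PowerSeries A) : LaurentSeries A).coeff i = _
  rw [PowerSeries.coeff_coe]
  simp

theorem toLaurent_injective (A : Type*) [CommRing A] : Function.Injective (toLaurent A) :=
  HahnSeries.ofPowerSeries_injective.comp (Polynomial.coe_injective A)

theorem laurentMap_toLaurent (π : R →+* F) (f : R[X]) :
    laurentMap π (toLaurent R f) = toLaurent F (f.map π) := by
  ext i
  rw [coeff_laurentMap, coeff_toLaurent, coeff_toLaurent]
  split_ifs <;> simp

theorem IsReduction.laurentMap_surjective (h : IsReduction π ϖ q) :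
    Function.Surjective (laurentMap π) := by
  classical
  intro y
  -- The section must send 0 to 0, so that the lifted series has no new support.
  let g : F → R := fun x => if x = 0 then 0 else (h.surjective x).choose
  have hg : ∀ x, π (g x) = x := fun x => by
    by_cases hx : x = 0
    · simp [g, hx]
    · simp only [g, hx, if_false]; exact (h.surjective x).choose_spec
  refine ⟨y.map (⟨g, by simp [g]⟩ : ZeroHom F R), ?_⟩
  ext i
  simp [hg]

theorem IsReduction.isNilpotent_of_laurentMap (h : IsReduction π ϖ q) (x : LaurentSeries R)
    (hx : laurentMap π x = 0) : IsNilpotent x := by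
  classical
  have hd : ∀ i, ϖ ∣ x.coeff i := fun i => by
    rw [← h.map_eq_zero_iff, ← coeff_laurentMap, hx, HahnSeries.coeff_zero]
  choose g hg using hd
  have hy : ∃ y : LaurentSeries R, x = HahnSeries.C ϖ * y := by
    -- Where `x` vanishes the quotient is set to 0, so its support stays partially well-ordered.
    refine ⟨⟨fun i => if x.coeff i = 0 then 0 else g i, x.isPWO_support.mono ?_⟩, ?_⟩
    · intro i hi
      rw [HahnSeries.mem_support]
      intro h0
      simp [h0] at hi
    · ext i
      rw [HahnSeries.C_mul_eq_smul, HahnSeries.coeff_smul]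
      by_cases h0 : x.coeff i = 0
      · simp [h0]
      · simp only [h0, if_false, smul_eq_mul]; exact hg i
  obtain ⟨y, rfl⟩ := hy
  exact (Commute.all _ _).isNilpotent_mul_right (h.isNilpotent.map HahnSeries.C)

theorem IsReduction.isUnit_laurent (h : IsReduction π ϖ q) {x : LaurentSeries R}
    (hx : laurentMap π x ≠ 0) : IsUnit x :=
  isUnit_of_isUnit_map h.laurentMap_surjective h.isNilpotent_of_laurentMap hx.isUnit

theorem IsReduction.isUnit_toLaurent (h : IsReduction π ϖ q) {f : R[X]} (hf : f.map π ≠ 0) :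
    IsUnit (toLaurent R f) := by
  refine h.isUnit_laurent ?_
  rw [laurentMap_toLaurent]
  exact fun h0 => hf (toLaurent_injective F (h0.trans (map_zero _).symm))

end Residue

/-! ### Encoders of a code and the module of reduced polynomial words. -/

section Encoders

variable {R F : Type*} [CommRing R] [Field F] {π : R →+* F} {ϖ q : R} {k n : ℕ}

/-- Coefficientwise reduction of a polynomial matrix along `π`. -/
abbrev reduceMatrix (π : R →+* F) (G : Matrix (Fin k) (Fin n) R[X]) :
    Matrix (Fin k) (Fin n) F[X] :=
  G.map (mapRingHom π)

/-- A vector of polynomials, viewed as a vector of Laurent series. -/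
def laurentVec (w : Fin n → R[X]) : Fin n → LaurentSeries R := fun j => toLaurent R (w j)

theorem laurentVec_injective : Function.Injective (laurentVec (R := R) (n := n)) :=
  fun _ _ h => funext fun j => toLaurent_injective R (congrFun h j)

theorem minor_reduceMatrix (G : Matrix (Fin k) (Fin n) R[X]) (e : Fin k ↪o Fin n) :
    minor (reduceMatrix π G) e = (minor G e).map π :=
  ((mapRingHom π).map_det (G.submatrix id e)).symm

theorem minor_mul {A : Type*} [CommRing A] (T : Matrix (Fin k) (Fin k) A[X])
    (G : Matrix (Fin k) (Fin n) A[X]) (e : Fin k ↪o Fin n) :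
    minor (T * G) e = T.det * minor G e := by
  rw [minor, minor, ← Matrix.det_mul]
  rfl

theorem det_laurentMatrix (G : Matrix (Fin k) (Fin n) R[X]) (e : Fin k ↪o Fin n) :
    ((laurentMatrix G).submatrix id e).det = toLaurent R (minor G e) :=
  ((toLaurent R).map_det (G.submatrix id e)).symm

theorem mem_code {G : Matrix (Fin k) (Fin n) R[X]} {x : Fin n → LaurentSeries R} :
    x ∈ code G ↔ ∃ v, Matrix.vecMul v (laurentMatrix G) = x := by
  simp [code, LinearMap.mem_range]

theorem laurentVec_vecMul (a : Fin k → R[X]) (G : Matrix (Fin k) (Fin n) R[X]) :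
    laurentVec (Matrix.vecMul a G) = Matrix.vecMul (laurentVec a) (laurentMatrix G) := by
  ext1 j
  exact RingHom.map_vecMul (toLaurent R) G a j

theorem laurentMap_vecMul (v : Fin k → LaurentSeries R) (G : Matrix (Fin k) (Fin n) R[X]) :
    (fun j => laurentMap π (Matrix.vecMul v (laurentMatrix G) j)) =
      Matrix.vecMul (fun i => laurentMap π (v i)) (laurentMatrix (reduceMatrix π G)) := by
  ext1 j
  rw [RingHom.map_vecMul]
  congr 1
  ext1 i j
  exact laurentMap_toLaurent π (G i j)

theorem vecMul_submatrix_cols {A : Type*} [CommRing A] (v : Fin k → A)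
    (M : Matrix (Fin k) (Fin n) A) (e : Fin k → Fin n) :
    Matrix.vecMul v (M.submatrix id e) = fun i => Matrix.vecMul v M (e i) := rfl

theorem eq_zero_of_vecMul_of_isUnit_det {A : Type*} [CommRing A] {v : Fin k → A}
    {M : Matrix (Fin k) (Fin n) A} {e : Fin k → Fin n} (he : IsUnit (M.submatrix id e).det)
    (h : ∀ i, Matrix.vecMul v M (e i) = 0) : v = 0 := by
  have h1 : Matrix.vecMul v (M.submatrix id e) = 0 := funext h
  exact Matrix.vecMul_injective_of_isUnit ((Matrix.isUnit_iff_isUnit_det _).2 he)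
    (h1.trans (Matrix.zero_vecMul _).symm)

theorem IsReduction.isUnit_det_laurentMatrix (h : IsReduction π ϖ q)
    {G : Matrix (Fin k) (Fin n) R[X]} {e : Fin k ↪o Fin n}
    (he : minor (reduceMatrix π G) e ≠ 0) :
    IsUnit ((laurentMatrix G).submatrix id e).det := by
  rw [det_laurentMatrix]
  exact h.isUnit_toLaurent (by rwa [← minor_reduceMatrix])

theorem linearIndependent_row_iff {A : Type*} [CommRing A] (M : Matrix (Fin k) (Fin n) A) :
    LinearIndependent A M.row ↔ ∀ v, Matrix.vecMul v M = 0 → v = 0 := by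
  rw [← Matrix.vecMul_injective_iff]
  exact injective_iff_map_eq_zero M.vecMulLinear

theorem IsReduction.exists_lift (h : IsReduction π ϖ q) {l : ℕ} (w : Fin l → F[X]) :
    ∃ a : Fin l → R[X], (fun i => (a i).map π) = w := by
  choose a ha using fun i => map_surjective π h.surjective (w i)
  exact ⟨a, funext ha⟩

theorem map_vecMul_reduceMatrix (a : Fin k → R[X]) (G : Matrix (Fin k) (Fin n) R[X]) :
    (fun j => (Matrix.vecMul a G j).map π) =
      Matrix.vecMul (fun i => (a i).map π) (reduceMatrix π G) :=
  funext fun j => RingHom.map_vecMul (mapRingHom π) G a j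

theorem IsReduction.C_mul_eq_zero_iff (h : IsReduction π ϖ q) (f : R[X]) :
    C q * f = 0 ↔ f.map π = 0 := by
  simp only [Polynomial.ext_iff, coeff_C_mul, coeff_zero, coeff_map, h.mul_eq_zero_iff]

/-- A relation among the reduced rows lifts and, multiplied by `q`, becomes a relation among the
rows of `G`. Independence makes `q` times the lift vanish, so the original relation was trivial. -/
theorem IsReduction.exists_minor_ne_zero (h : IsReduction π ϖ q)
    {G : Matrix (Fin k) (Fin n) R[X]} (hG : FullRowRank G) :
    ∃ e, minor (reduceMatrix π G) e ≠ 0 := by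
  refine exists_det_ne_zero_of_domain (reduceMatrix π G) ?_
  rw [FullRowRank, linearIndependent_row_iff] at hG
  rw [linearIndependent_row_iff]
  intro v hv
  obtain ⟨a, rfl⟩ := h.exists_lift v
  rw [← map_vecMul_reduceMatrix] at hv
  have h1 : Matrix.vecMul (C q • a) G = 0 := by
    rw [Matrix.smul_vecMul]
    ext1 j
    exact (h.C_mul_eq_zero_iff _).2 (congrFun hv j)
  have h2 := hG (laurentVec (C q • a)) (by
    rw [← laurentVec_vecMul, h1]
    exact funext fun _ => map_zero _)
  ext1 i
  refine (h.C_mul_eq_zero_iff _).1 (toLaurent_injective R ?_)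
  rw [map_zero]
  exact congrFun h2 i

theorem IsReduction.fullRowRank (h : IsReduction π ϖ q)
    {G : Matrix (Fin k) (Fin n) R[X]} {e : Fin k ↪o Fin n}
    (he : minor (reduceMatrix π G) e ≠ 0) : FullRowRank G := by
  rw [FullRowRank, linearIndependent_row_iff]
  intro v hv
  exact eq_zero_of_vecMul_of_isUnit_det (h.isUnit_det_laurentMatrix he)
    fun i => congrFun hv (e i)

variable {C : Submodule (LaurentSeries R) (Fin n → LaurentSeries R)}

/-- Polynomial words of a code form the rows of a matrix `T G` over `R((D))`. -/
theorem exists_laurentMatrix_eq_mul {G E : Matrix (Fin k) (Fin n) R[X]} (hG : IsEncoder C G)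
    (hE : ∀ i, laurentVec (E i) ∈ C) :
    ∃ T : Matrix (Fin k) (Fin k) (LaurentSeries R), laurentMatrix E = T * laurentMatrix G := by
  have h : ∀ i, ∃ v, Matrix.vecMul v (laurentMatrix G) = laurentVec (E i) := fun i =>
    mem_code.1 (hG.2.symm ▸ hE i)
  choose T hT using h
  exact ⟨Matrix.of T, Matrix.ext fun i j => (congrFun (hT i) j).symm⟩

theorem toLaurent_minor_eq {G E : Matrix (Fin k) (Fin n) R[X]}
    {T : Matrix (Fin k) (Fin k) (LaurentSeries R)} (hT : laurentMatrix E = T * laurentMatrix G)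
    (e : Fin k ↪o Fin n) :
    toLaurent R (minor E e) = T.det * toLaurent R (minor G e) := by
  rw [← det_laurentMatrix, ← det_laurentMatrix, hT, ← Matrix.det_mul]
  rfl

/-- Both families of minors differ by the common factor `det T`, possibly not a polynomial;
cross-multiplying eliminates it. -/
theorem minor_mul_minor {G E : Matrix (Fin k) (Fin n) R[X]} (hG : IsEncoder C G)
    (hE : ∀ i, laurentVec (E i) ∈ C) (e e' : Fin k ↪o Fin n) :
    minor E e * minor G e' = minor E e' * minor G e := by
  obtain ⟨T, hT⟩ := exists_laurentMatrix_eq_mul hG hE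
  apply toLaurent_injective R
  rw [map_mul, map_mul, toLaurent_minor_eq hT, toLaurent_minor_eq hT]
  ring

theorem code_le_of_eq_mul {G E : Matrix (Fin k) (Fin n) R[X]}
    {T : Matrix (Fin k) (Fin k) (LaurentSeries R)}
    (hT : laurentMatrix E = T * laurentMatrix G) : code E ≤ code G := by
  intro x hx
  obtain ⟨v, rfl⟩ := mem_code.1 hx
  exact mem_code.2 ⟨Matrix.vecMul v T, by rw [hT, Matrix.vecMul_vecMul]⟩

/-- A nonzero reduced minor makes the corresponding minor of `E` a unit of `R((D))`. It is a
multiple of `det T`, so `T` is invertible and `E` generates all of `C`. -/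
theorem IsReduction.isEncoder (h : IsReduction π ϖ q) {G E : Matrix (Fin k) (Fin n) R[X]}
    (hG : IsEncoder C G) (hE : ∀ i, laurentVec (E i) ∈ C) {e : Fin k ↪o Fin n}
    (he : minor (reduceMatrix π E) e ≠ 0) : IsEncoder C E := by
  obtain ⟨T, hT⟩ := exists_laurentMatrix_eq_mul hG hE
  refine ⟨h.fullRowRank he, ?_⟩
  have hu := h.isUnit_det_laurentMatrix he
  rw [det_laurentMatrix, toLaurent_minor_eq hT] at hu
  have hTu : IsUnit T.det := isUnit_of_mul_isUnit_left hu
  have hT' : laurentMatrix G = T⁻¹ * laurentMatrix E := by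
    rw [hT, ← Matrix.mul_assoc, Matrix.nonsing_inv_mul _ hTu, Matrix.one_mul]
  rw [← hG.2]
  exact le_antisymm (code_le_of_eq_mul hT) (code_le_of_eq_mul hT')

theorem IsEncoder.row_mem {G : Matrix (Fin k) (Fin n) R[X]} (hG : IsEncoder C G) (i : Fin k) :
    laurentVec (G i) ∈ C := by
  rw [← hG.2]
  exact mem_code.2 ⟨Pi.single i 1, by rw [Matrix.single_one_vecMul]; rfl⟩

theorem laurentVec_mem_smul {w : Fin n → R[X]} (hw : laurentVec w ∈ C) (a : R[X]) :
    laurentVec (a • w) ∈ C := by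
  have : laurentVec (a • w) = toLaurent R a • laurentVec w :=
    funext fun j => map_mul _ _ _
  rw [this]
  exact C.smul_mem _ hw

/-- Reductions of the polynomial words of `C`. -/
def residueModule (h : IsReduction π ϖ q)
    (C : Submodule (LaurentSeries R) (Fin n → LaurentSeries R)) :
    Submodule F[X] (Fin n → F[X]) where
  carrier := {w | ∃ m : Fin n → R[X], laurentVec m ∈ C ∧ (fun j => (m j).map π) = w}
  zero_mem' := ⟨0, by
    convert C.zero_mem
    exact funext fun _ => map_zero _, by ext; simp⟩
  add_mem' := by
    rintro _ _ ⟨m, hm, rfl⟩ ⟨m', hm', rfl⟩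
    refine ⟨m + m', ?_, by ext; simp⟩
    have : laurentVec (m + m') = laurentVec m + laurentVec m' := funext fun j => map_add _ _ _
    rw [this]
    exact C.add_mem hm hm'
  smul_mem' := by
    rintro c _ ⟨m, hm, rfl⟩
    obtain ⟨a, rfl⟩ := map_surjective π h.surjective c
    exact ⟨a • m, laurentVec_mem_smul hm a, by ext; simp⟩

/-- A reduced word is a combination of the reduced rows of `G` over `F((D))`, so it is determined by
`k` columns carrying a nonzero minor. Conversely, the reduced rows of `G` are `k` independent
elements. -/
theorem IsReduction.finrank_residueModule (h : IsReduction π ϖ q)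
    {G : Matrix (Fin k) (Fin n) R[X]} (hG : IsEncoder C G) :
    Module.finrank F[X] (residueModule h C) = k := by
  obtain ⟨e, he⟩ := h.exists_minor_ne_zero hG.1
  apply le_antisymm
  · let f : residueModule h C →ₗ[F[X]] (Fin k → F[X]) :=
      (LinearMap.funLeft F[X] F[X] e).comp (residueModule h C).subtype
    have hf : Function.Injective f := by
      rw [injective_iff_map_eq_zero]
      rintro ⟨_, m, hm, rfl⟩ hfm
      obtain ⟨v, hv⟩ := mem_code.1 (hG.2.symm ▸ hm)
      have hv' := laurentMap_vecMul (π := π) v G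
      rw [hv] at hv'
      have hm' : (fun j => laurentMap π (laurentVec m j)) =
          laurentVec (fun j => (m j).map π) := funext fun j => laurentMap_toLaurent π (m j)
      rw [hm'] at hv'
      have hdet : IsUnit ((laurentMatrix (reduceMatrix π G)).submatrix id e).det := by
        rw [det_laurentMatrix]
        refine (isUnit_iff_ne_zero.2 fun h0 => he (toLaurent_injective F ?_))
        rw [h0, map_zero]
      have hv0 := eq_zero_of_vecMul_of_isUnit_det hdet fun i => by
        rw [← hv']
        have := congrFun hfm i
        change (m (e i)).map π = 0 at this
        rw [laurentVec, this, map_zero]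
      rw [hv0, Matrix.zero_vecMul] at hv'
      apply Subtype.ext
      apply laurentVec_injective
      rw [hv']
      exact funext fun _ => (map_zero _).symm
    simpa using LinearMap.finrank_le_finrank_of_injective hf
  · have hli : LinearIndependent F[X] (reduceMatrix π G).row := by
      rw [linearIndependent_row_iff]
      intro v hv
      have h1 := Matrix.eq_zero_of_vecMul_eq_zero he (v := v)
        (by rw [vecMul_submatrix_cols, hv]; rfl)
      exact h1
    let b : Fin k → residueModule h C := fun i =>
      ⟨(reduceMatrix π G).row i, G i, hG.row_mem i, rfl⟩
    have hb : LinearIndependent F[X] b :=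
      LinearIndependent.of_comp (residueModule h C).subtype hli
    simpa using hb.fintype_card_le_finrank

/-- An encoder whose reduction is a basis of the reductions of all polynomial words. -/
theorem IsReduction.exists_basic (h : IsReduction π ϖ q)
    {G : Matrix (Fin k) (Fin n) R[X]} (hG : IsEncoder C G) :
    ∃ E : Matrix (Fin k) (Fin n) R[X], IsEncoder C E ∧
      ∀ G' : Matrix (Fin k) (Fin n) R[X], IsEncoder C G' →
        ∃ X : Matrix (Fin k) (Fin k) F[X], reduceMatrix π G' = X * reduceMatrix π E := by
  let b := Module.finBasisOfFinrankEq F[X] (residueModule h C) (h.finrank_residueModule hG)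
  have hb := fun i => (b i).2
  choose E hEC hE using hb
  have hX : ∀ G' : Matrix (Fin k) (Fin n) R[X], IsEncoder C G' →
      ∃ X : Matrix (Fin k) (Fin k) F[X], reduceMatrix π G' = X * reduceMatrix π (Matrix.of E) := by
    intro G' hG'
    let w : Fin k → residueModule h C := fun i => ⟨fun j => (G' i j).map π, G' i, hG'.row_mem i, rfl⟩
    refine ⟨Matrix.of fun i l => b.repr (w i) l, ?_⟩
    ext1 i j
    have h1 := congrArg (fun x : residueModule h C => (x : Fin n → F[X]) j) (b.sum_repr (w i))
    simp only [Submodule.coe_sum, Submodule.coe_smul, Finset.sum_apply, Pi.smul_apply,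
      smul_eq_mul, ← hE] at h1
    exact h1.symm
  refine ⟨Matrix.of E, ?_, hX⟩
  obtain ⟨X, hXG⟩ := hX G hG
  obtain ⟨e, he⟩ := h.exists_minor_ne_zero hG.1
  refine h.isEncoder hG hEC (e := e) fun h0 => he ?_
  rw [hXG, minor_mul, h0, mul_zero]

end Encoders

/-! ### Comparison of a RIDM with the basic encoder. -/

section Ridm

variable {R F : Type*} [CommRing R] [Field F] {π : R →+* F} {ϖ q : R} {k n : ℕ}
  {C : Submodule (LaurentSeries R) (Fin n → LaurentSeries R)}

theorem IsEncoder.row_mul_mem {G : Matrix (Fin k) (Fin n) R[X]} (hG : IsEncoder C G)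
    (T : Matrix (Fin k) (Fin k) R[X]) (i : Fin k) : laurentVec ((T * G) i) ∈ C := by
  rw [← hG.2]
  exact mem_code.2 ⟨laurentVec (T i), by rw [← laurentVec_vecMul]; rfl⟩

theorem exists_det_eq {A : Type*} [CommRing A] (hk : 0 < k) (u : A) :
    ∃ T : Matrix (Fin k) (Fin k) A, T.det = u := by
  refine ⟨Matrix.diagonal (Function.update 1 ⟨0, hk⟩ u), ?_⟩
  rw [Matrix.det_diagonal, Finset.prod_update_of_mem (Finset.mem_univ _)]
  simp

/-- The minors of an encoder can be multiplied by any unit of `R[D]`. -/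
theorem IsReduction.exists_isEncoder_minor_eq (h : IsReduction π ϖ q) (hk : 0 < k)
    {E : Matrix (Fin k) (Fin n) R[X]} (hE : IsEncoder C E) {u : R[X]} (hu : IsUnit u) :
    ∃ E' : Matrix (Fin k) (Fin n) R[X], IsEncoder C E' ∧ ∀ e, minor E' e = u * minor E e := by
  obtain ⟨T, rfl⟩ := exists_det_eq hk u
  obtain ⟨e, he⟩ := h.exists_minor_ne_zero hE.1
  refine ⟨T * E, h.isEncoder hE (hE.row_mul_mem T) (e := e) ?_, fun e => minor_mul T E e⟩
  rw [minor_reduceMatrix] at he ⊢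
  rw [minor_mul, Polynomial.map_mul]
  exact mul_ne_zero (hu.map (mapRingHom π)).ne_zero he

theorem IsReduction.isUnit_det_of_isRIDM (h : IsReduction π ϖ q)
    {G E : Matrix (Fin k) (Fin n) R[X]} (hG : IsRIDM G) (hGC : code G = C) (hE : IsEncoder C E)
    {T : Matrix (Fin k) (Fin k) F[X]} (hT : reduceMatrix π G = T * reduceMatrix π E) :
    IsUnit T.det := by
  have hR : Nontrivial R := π.domain_nontrivial
  obtain rfl | hk := Nat.eq_zero_or_pos k
  · simp
  have hGenc : IsEncoder C G := ⟨hG.1, hGC⟩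
  obtain ⟨e₀, he₀⟩ := h.exists_minor_ne_zero hG.1
  have hred := minor_mul T (reduceMatrix π E) e₀
  rw [← hT] at hred
  rw [hred] at he₀
  obtain ⟨hT0, hE0⟩ := mul_ne_zero_iff.1 he₀
  have hred' : (minor G e₀).map π = T.det * (minor E e₀).map π := by
    rw [← minor_reduceMatrix, ← minor_reduceMatrix, hred]
  rw [minor_reduceMatrix] at hE0
  obtain ⟨u, a, hu, hua, ham, had⟩ := h.exists_isUnit_mul_monic (minor E e₀) hE0
  obtain ⟨v, b, hv, hvb, hbm, hbd⟩ := h.exists_isUnit_mul_monic (minor G e₀)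
    (by rw [hred']; exact mul_ne_zero hT0 hE0)
  rw [hred', natDegree_mul hT0 hE0, ← had] at hbd
  obtain ⟨w, hw⟩ := hv.exists_left_inv
  have hwu : IsUnit w := isUnit_of_mul_isUnit_left (hw ▸ isUnit_one)
  -- Multiplication by a unit of `R[D]` can change degrees, so the minors of `E` are first rescaled
  -- by `v⁻¹ u`. The proportionality factors then become the monic `a` and `b`, for which degrees
  -- add despite zero divisors.
  obtain ⟨E', hE'C, hE'⟩ := h.exists_isEncoder_minor_eq hk hE (hwu.mul hu)
  have hprop : ∀ e, a * minor G e = b * minor E' e := by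
    intro e
    have h1 := minor_mul_minor hE hGenc.row_mem e e₀
    rw [hE', ← hua, ← hvb]
    linear_combination u * h1 - u * minor G e₀ * minor E e * hw
  have hdeg : ∀ e, minor G e ≠ 0 →
      (minor G e).natDegree = (minor E' e).natDegree + T.det.natDegree := by
    intro e hne
    have hne' : minor E' e ≠ 0 := by
      intro h0
      have h1 := hprop e
      rw [h0, mul_zero] at h1
      exact hne ((ham.mul_right_eq_zero_iff).1 h1)
    have h1 := congrArg natDegree (hprop e)
    rw [ham.natDegree_mul' hne, hbm.natDegree_mul' hne'] at h1
    omega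
  have hle : ∀ e, (minor G e).natDegree ≤ intdeg G := fun e =>
    Finset.le_sup (f := fun e => (minor G e).natDegree) (Finset.mem_univ e)
  have hG0 : minor G e₀ ≠ 0 := by
    intro h0
    rw [h0, Polynomial.map_zero] at hred'
    exact mul_ne_zero hT0 hE0 hred'.symm
  suffices hd : T.det.natDegree = 0 by
    rw [eq_C_of_natDegree_eq_zero hd]
    rw [eq_C_of_natDegree_eq_zero hd, Ne, C_eq_zero] at hT0
    exact (isUnit_iff_ne_zero.2 hT0).map Polynomial.C
  by_contra hd
  have hmin := hG.2 E' (hGC ▸ hE'C)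
  -- Vanishing minors have `natDegree` 0, so the strict bound on the supremum needs a positive
  -- internal degree.
  have hpos : 0 < intdeg G := by
    have := hle e₀
    have := hdeg e₀ hG0
    omega
  refine absurd hmin (not_le.2 ((Finset.sup_lt_iff hpos).2 fun e _ => ?_))
  by_cases hne : minor G e = 0
  · have h1 := hprop e
    rw [hne, mul_zero] at h1
    rw [(hbm.mul_right_eq_zero_iff).1 h1.symm]
    simpa using hpos
  · have := hle e
    have := hdeg e hne
    omega

end Ridm

/-! ### The gcd of the maximal minors over a field. -/

section MinorsGCD

variable {F : Type*} [Field F] [DecidableEq F] {k n : ℕ}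

theorem minorsGCD_dvd (G : Matrix (Fin k) (Fin n) F[X]) (e : Fin k ↪o Fin n) :
    minorsGCD G ∣ minor G e :=
  letI : NormalizedGCDMonoid F[X] := UniqueFactorizationMonoid.toNormalizedGCDMonoid F[X]
  Finset.gcd_dvd (Finset.mem_univ e)

theorem dvd_minorsGCD {G : Matrix (Fin k) (Fin n) F[X]} {d : F[X]}
    (h : ∀ e, d ∣ minor G e) : d ∣ minorsGCD G :=
  letI : NormalizedGCDMonoid F[X] := UniqueFactorizationMonoid.toNormalizedGCDMonoid F[X]
  Finset.dvd_gcd fun e _ => h e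

theorem normalize_minorsGCD (G : Matrix (Fin k) (Fin n) F[X]) :
    normalize (minorsGCD G) = minorsGCD G :=
  letI : NormalizedGCDMonoid F[X] := UniqueFactorizationMonoid.toNormalizedGCDMonoid F[X]
  Finset.normalize_gcd

theorem minorsGCD_mul_dvd (T : Matrix (Fin k) (Fin k) F[X]) (G : Matrix (Fin k) (Fin n) F[X]) :
    minorsGCD G ∣ minorsGCD (T * G) :=
  dvd_minorsGCD fun e => by
    rw [minor_mul]
    exact Dvd.dvd.mul_left (minorsGCD_dvd G e) _

theorem minorsGCD_mul_of_isUnit {T : Matrix (Fin k) (Fin k) F[X]} (hT : IsUnit T.det)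
    (G : Matrix (Fin k) (Fin n) F[X]) : minorsGCD (T * G) = minorsGCD G := by
  rw [← normalize_minorsGCD (T * G), ← normalize_minorsGCD G]
  refine normalize_eq_normalize (dvd_minorsGCD fun e => ?_) (minorsGCD_mul_dvd T G)
  have h := minorsGCD_dvd (T * G) e
  rwa [minor_mul, hT.dvd_mul_left] at h

/-- The gcd of the minors is a combination of the minors. -/
theorem exists_sum_minor_eq (G : Matrix (Fin k) (Fin n) F[X]) :
    ∃ c : (Fin k ↪o Fin n) → F[X], ∑ e, c e * minor G e = minorsGCD G := by
  have hspan : minorsGCD G ∈ Ideal.span (Set.range (minor G)) := by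
    obtain ⟨d, hd⟩ := IsPrincipalIdealRing.principal (Ideal.span (Set.range (minor G)))
    rw [← Ideal.span] at hd
    rw [hd, Ideal.mem_span_singleton]
    refine dvd_minorsGCD fun e => ?_
    rw [← Ideal.mem_span_singleton, ← hd]
    exact Ideal.subset_span ⟨e, rfl⟩
  rw [Ideal.mem_span_range_iff_exists_fun] at hspan
  exact hspan

theorem eq_X_pow_of_irreducible_dvd {f : F[X]} (hf : f ≠ 0) (hn : normalize f = f)
    (h : ∀ Q : F[X], Irreducible Q → Q ∣ f → Associated Q X) : ∃ s : ℕ, f = X ^ s := by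
  obtain ⟨s, g, hg, hfg⟩ := WfDvdMonoid.max_power_factor hf (irreducible_X (R := F))
  have hgu : IsUnit g := by
    by_contra hgu
    have hg0 : g ≠ 0 := by rintro rfl; exact hg (dvd_zero _)
    obtain ⟨Q, hQ, hQg⟩ := WfDvdMonoid.exists_irreducible_factor hgu hg0
    exact hg ((h Q hQ (hfg ▸ Dvd.dvd.mul_left hQg _)).symm.dvd.trans hQg)
  refine ⟨s, ?_⟩
  rw [← hn, ← (monic_X_pow s).normalize_eq_self, normalize_eq_normalize_iff_associated, hfg]
  exact (associated_mul_unit_left _ _ hgu)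

end MinorsGCD

/-! ### Finite weight and the catastrophicity criteria. -/

section FiniteWeight

variable {R F : Type*} [CommRing R] [Field F] {π : R →+* F} {ϖ q : R} {k n : ℕ}

theorem wt_lt_top_iff {u : Fin k → LaurentSeries R} :
    wt u < ⊤ ↔ ∀ i, (u i).support.Finite := by
  have h : wt u < ⊤ ↔ ∀ i ∈ Finset.univ, (Function.support (u i).coeff).encard < ⊤ :=
    WithTop.sum_lt_top
  rw [h]
  exact ⟨fun h i => Set.encard_lt_top_iff.1 (h i (Finset.mem_univ i)),
    fun h i _ => Set.encard_lt_top_iff.2 (h i)⟩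

theorem support_mul_finite {x y : LaurentSeries R} (hx : x.support.Finite)
    (hy : y.support.Finite) : (x * y).support.Finite :=
  (hx.add hy).subset HahnSeries.support_mul_subset

theorem support_sum_finite {ι : Type*} (s : Finset ι) {x : ι → LaurentSeries R}
    (hx : ∀ i ∈ s, (x i).support.Finite) : (∑ i ∈ s, x i).support.Finite := by
  classical
  induction s using Finset.induction_on with
  | empty => simp
  | insert a s ha ih =>
    rw [Finset.sum_insert ha]
    exact ((hx a (Finset.mem_insert_self a s)).union
      (ih fun i hi => hx i (Finset.mem_insert_of_mem hi))).subset
        (HahnSeries.support_add_subset _ _)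

theorem support_toLaurent_finite (f : R[X]) : (toLaurent R f).support.Finite := by
  refine (f.support.finite_toSet.image (Nat.cast : ℕ → ℤ)).subset fun i hi => ?_
  rw [HahnSeries.mem_support, coeff_toLaurent] at hi
  split_ifs at hi with h0
  · exact absurd rfl hi
  · exact ⟨i.natAbs, mem_support_iff.2 hi, by omega⟩

theorem wt_vecMul_lt_top {u : Fin k → LaurentSeries R} (hu : wt u < ⊤)
    (G : Matrix (Fin k) (Fin n) R[X]) : wt (Matrix.vecMul u (laurentMatrix G)) < ⊤ := by
  rw [wt_lt_top_iff] at hu ⊢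
  exact fun j => support_sum_finite _ fun i _ =>
    support_mul_finite (hu i) (support_toLaurent_finite (G i j))

theorem toLaurent_X_pow (N : ℕ) : toLaurent R (X ^ N) = HahnSeries.single (N : ℤ) 1 := by
  ext i
  rw [coeff_toLaurent, coeff_X_pow, HahnSeries.coeff_single]
  split_ifs <;> first | rfl | omega

theorem support_finite_of_X_pow_mul {x : LaurentSeries R} {N : ℕ}
    (h : (toLaurent R (X ^ N) * x).support.Finite) : x.support.Finite := by
  have hx : x = HahnSeries.single (-(N : ℤ)) 1 * (toLaurent R (X ^ N) * x) := by
    rw [toLaurent_X_pow, ← mul_assoc, HahnSeries.single_mul_single]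
    simp
  rw [hx]
  exact support_mul_finite ((Set.finite_singleton _).subset HahnSeries.support_single_subset) h

/-- A Laurent series with finitely many nonzero coefficients is a polynomial up to a shift. -/
theorem exists_X_pow_mul_eq_toLaurent {x : LaurentSeries R} (hx : x.support.Finite) :
    ∃ (N : ℕ) (f : R[X]), toLaurent R (X ^ N) * x = toLaurent R f := by
  classical
  obtain ⟨B, hB⟩ := hx.bddBelow
  let N := B.natAbs
  refine ⟨N, ∑ i ∈ hx.toFinset, monomial (i + N).toNat (x.coeff i), ?_⟩
  ext j
  have hc : (toLaurent R (X ^ N) * x).coeff j = x.coeff (j - N) := by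
    have := HahnSeries.coeff_single_mul_add (r := (1 : R)) (x := x) (a := j - N) (b := (N : ℤ))
    rw [sub_add_cancel, one_mul] at this
    rw [toLaurent_X_pow, this]
  rw [hc, coeff_toLaurent]
  split_ifs with hj
  · by_contra hne
    have : B ≤ j - N := hB (a := j - N) hne
    omega
  · rw [finsetSum_coeff]
    simp only [coeff_monomial]
    by_cases h0 : x.coeff (j - N) = 0
    · rw [h0]
      refine (Finset.sum_eq_zero fun i hi => ?_).symm
      have hi' : x.coeff i ≠ 0 := (hx.mem_toFinset).1 hi
      have hBi : B ≤ i := hB (a := i) hi'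
      rw [if_neg]
      intro hij
      apply hi'
      rw [show i = j - N by omega, h0]
    · rw [Finset.sum_eq_single (j - N)]
      · rw [if_pos (by omega)]
      · intro i hi hij
        have hBi : B ≤ i := hB (a := i) ((hx.mem_toFinset).1 hi)
        rw [if_neg (by omega)]
      · exact fun hn => absurd ((hx.mem_toFinset).2 h0) hn

/-- Transfers weights over `F` to weights over `R`: multiplication by `q` erases everything but the
residue. -/
theorem IsReduction.support_C_mul (h : IsReduction π ϖ q) (x : LaurentSeries R) :
    (HahnSeries.C q * x).support = (laurentMap π x).support := by
  ext i
  rw [HahnSeries.mem_support, HahnSeries.mem_support, HahnSeries.C_mul_eq_smul,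
    HahnSeries.coeff_smul, smul_eq_mul, coeff_laurentMap, Ne, h.mul_eq_zero_iff]

/-- A polynomial matrix all of whose minors are divisible by `Q` has a nontrivial combination of
rows divisible by `Q`. -/
theorem exists_vecMul_dvd {Q : F[X]} (hQ : Irreducible Q) (G : Matrix (Fin k) (Fin n) F[X])
    (h : ∀ e, Q ∣ minor G e) :
    ∃ a : Fin k → F[X], (∃ i, ¬ Q ∣ a i) ∧ ∀ j, Q ∣ Matrix.vecMul a G j := by
  have : Fact (Irreducible Q) := ⟨hQ⟩
  let f := AdjoinRoot.mk Q
  -- All maximal minors vanish over the field `F[X]/(Q)`, so the rows are dependent there.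
  have hli : ¬ LinearIndependent (AdjoinRoot Q) (G.map f).row := by
    intro hli
    obtain ⟨e, he⟩ := exists_minor_ne_zero_of_field _ hli
    apply he
    have : (G.map f).submatrix id e = f.mapMatrix (G.submatrix id e) := rfl
    rw [this, ← RingHom.map_det]
    exact AdjoinRoot.mk_eq_zero.2 (h e)
  rw [linearIndependent_row_iff] at hli
  push Not at hli
  obtain ⟨v, hv, hv0⟩ := hli
  choose a ha using fun i => AdjoinRoot.mk_surjective (g := Q) (v i)
  obtain rfl : (fun i => f (a i)) = v := funext ha
  refine ⟨a, ?_, fun j => ?_⟩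
  · by_contra! hd
    exact hv0 (funext fun i => AdjoinRoot.mk_eq_zero.2 (hd i))
  · rw [← AdjoinRoot.mk_eq_zero]
    exact (RingHom.map_vecMul f G a j).trans (congrFun hv j)

/-- The witness is `q v` with `v` a lift of `a/Q`: the output has the support of the polynomial
vector `w = aG/Q`, while finite support of `a i / Q` would give `Q ∣ X^N * a i`, impossible for the
chosen `i`. -/
theorem IsReduction.not_nonCatastrophic (h : IsReduction π ϖ q)
    {G : Matrix (Fin k) (Fin n) R[X]} {Q : F[X]} (hQ : Irreducible Q)
    (hQX : ¬ Associated Q X) (hd : ∀ e, Q ∣ minor (reduceMatrix π G) e) :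
    ¬ NonCatastrophic G := by
  intro hG
  obtain ⟨a, ⟨i, hi⟩, haG⟩ := exists_vecMul_dvd hQ (reduceMatrix π G) hd
  choose w hw using haG
  have hQ0 : toLaurent F Q ≠ 0 := fun h0 =>
    hQ.ne_zero (toLaurent_injective F (h0.trans (map_zero _).symm))
  choose v hv using fun i => h.laurentMap_surjective ((toLaurent F Q)⁻¹ * toLaurent F (a i))
  have hvG : (fun j => laurentMap π (Matrix.vecMul v (laurentMatrix G) j)) = laurentVec w := by
    rw [laurentMap_vecMul]
    have h1 : (fun i => laurentMap π (v i)) = (toLaurent F Q)⁻¹ • laurentVec a := funext hv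
    rw [h1, Matrix.smul_vecMul, ← laurentVec_vecMul]
    ext1 j
    rw [Pi.smul_apply, laurentVec, hw, map_mul, smul_eq_mul, inv_mul_cancel_left₀ hQ0]
    rfl
  have hfin : wt (Matrix.vecMul ((HahnSeries.C q : LaurentSeries R) • v) (laurentMatrix G)) < ⊤ := by
    rw [Matrix.smul_vecMul, wt_lt_top_iff]
    intro j
    rw [Pi.smul_apply, smul_eq_mul, h.support_C_mul, congrFun hvG j]
    exact support_toLaurent_finite _
  have hfin' := wt_lt_top_iff.1 ((hG _).1 hfin) i
  rw [Pi.smul_apply, smul_eq_mul, h.support_C_mul, hv] at hfin'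
  obtain ⟨N, f, hf⟩ := exists_X_pow_mul_eq_toLaurent hfin'
  have hdvd : X ^ N * a i = Q * f := by
    apply toLaurent_injective F
    rw [map_mul, map_mul, ← hf, mul_left_comm, mul_inv_cancel_left₀ hQ0]
  rcases hQ.prime.dvd_or_dvd ⟨f, hdvd⟩ with h1 | h1
  · exact hQX (hQ.associated_of_dvd irreducible_X (hQ.prime.dvd_of_dvd_pow h1))
  · exact hi h1

/-- A right inverse up to the scalar `d` from the minor on the columns `e`. -/
theorem exists_mul_eq_smul_minor {A : Type*} [CommRing A] (G : Matrix (Fin k) (Fin n) A[X])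
    (e : Fin k ↪o Fin n) :
    ∃ H : Matrix (Fin n) (Fin k) A[X], G * H = minor G e • 1 := by
  refine ⟨(1 : Matrix (Fin n) (Fin n) A[X]).submatrix id e * (G.submatrix id e).adjugate, ?_⟩
  have h : G * (1 : Matrix (Fin n) (Fin n) A[X]).submatrix id e = G.submatrix id e := by
    ext1 i j
    simp [Matrix.mul_apply, Matrix.one_apply]
  rw [← Matrix.mul_assoc, h, Matrix.mul_adjugate]
  rfl

/-- The difference `X^s - f` is nilpotent, and `f` divides `(X^s)^N - (X^s - f)^N`. -/
theorem IsReduction.exists_mul_eq_X_pow (h : IsReduction π ϖ q) {f : R[X]} {s : ℕ}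
    (hf : f.map π = X ^ s) : ∃ (g : R[X]) (N : ℕ), f * g = X ^ N := by
  have hd : C ϖ ∣ X ^ s - f := by
    rw [C_dvd_iff_dvd_coeff]
    intro i
    rw [← h.map_eq_zero_iff, ← coeff_map, Polynomial.map_sub, hf, Polynomial.map_pow, map_X,
      sub_self, coeff_zero]
  obtain ⟨y, hy⟩ := hd
  obtain ⟨N, hN⟩ := h.isNilpotent
  obtain ⟨g, hg⟩ := sub_dvd_pow_sub_pow (X ^ s : R[X]) (X ^ s - f) N
  rw [sub_sub_cancel, hy, mul_pow, ← C_pow, hN, C_0, zero_mul, sub_zero, ← pow_mul] at hg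
  exact ⟨g, s * N, hg.symm⟩

/-- Lifted Bézout coefficients combine the adjugate inverses into a polynomial right inverse of `G`
up to a power of `X`. Applying it to a finite-weight output recovers a shift of the input. -/
theorem IsReduction.nonCatastrophic [DecidableEq F] (h : IsReduction π ϖ q)
    {G : Matrix (Fin k) (Fin n) R[X]} {s : ℕ}
    (hG : minorsGCD (reduceMatrix π G) = X ^ s) : NonCatastrophic G := by
  obtain ⟨c, hc⟩ := exists_sum_minor_eq (reduceMatrix π G)
  choose b hb using fun e => map_surjective π h.surjective (c e)
  choose H hH using exists_mul_eq_smul_minor G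
  set f := ∑ e, b e * minor G e with hfdef
  have hf : f.map π = X ^ s := by
    rw [← hG, ← hc, hfdef, Polynomial.map_sum]
    simp only [Polynomial.map_mul, hb, minor_reduceMatrix]
  obtain ⟨g, N, hg⟩ := h.exists_mul_eq_X_pow hf
  have hinv : G * (g • ∑ e, b e • H e) = (X ^ N : R[X]) • 1 := by
    rw [Matrix.mul_smul, Matrix.mul_sum]
    simp only [Matrix.mul_smul, hH, smul_smul]
    rw [← Finset.sum_smul, ← hfdef, smul_smul, mul_comm, hg]
  set H' := g • ∑ e, b e • H e
  refine fun u => ⟨fun hu => ?_, fun hu => wt_vecMul_lt_top hu G⟩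
  have h1 := wt_lt_top_iff.1 (wt_vecMul_lt_top hu H')
  have h2 : laurentMatrix G * laurentMatrix H' = toLaurent R (X ^ N) • 1 := by
    rw [laurentMatrix, laurentMatrix, ← Matrix.map_mul, hinv]
    ext1 i j
    by_cases hij : i = j <;> simp [hij]
  rw [Matrix.vecMul_vecMul, h2, Matrix.vecMul_smul, Matrix.vecMul_one] at h1
  exact wt_lt_top_iff.2 fun i => support_finite_of_X_pow_mul (h1 i)

end FiniteWeight

/-! ### The case of `ℤ/p^r`, with `ϖ = p` and `q = p^(r-1)`. -/

section ZModReduction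

theorem isReduction_zmod (p r : ℕ) [Fact p.Prime] [NeZero r] :
    IsReduction (ZMod.castHom (dvd_pow_self p (NeZero.ne r)) (ZMod p))
      (p : ZMod (p ^ r)) ((p : ZMod (p ^ r)) ^ (r - 1)) where
  surjective := ZMod.castHom_surjective _
  map_eq_zero_iff x := by
    obtain ⟨m, rfl⟩ := ZMod.natCast_zmod_surjective x
    rw [map_natCast, ZMod.natCast_eq_zero_iff]
    constructor
    · rintro ⟨c, rfl⟩
      exact ⟨c, by push_cast; rfl⟩
    · rintro ⟨y, hy⟩
      obtain ⟨c, rfl⟩ := ZMod.natCast_zmod_surjective y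
      have h1 := congrArg (ZMod.castHom (dvd_pow_self p (NeZero.ne r)) (ZMod p)) hy
      rw [map_mul, map_natCast, map_natCast, ZMod.natCast_self, zero_mul] at h1
      exact (ZMod.natCast_eq_zero_iff _ _).1 h1
  isNilpotent := ⟨r, by rw [← Nat.cast_pow, ZMod.natCast_self]⟩
  mul_eq_zero_iff x := by
    obtain ⟨m, rfl⟩ := ZMod.natCast_zmod_surjective x
    rw [map_natCast, ZMod.natCast_eq_zero_iff, ← Nat.cast_pow, ← Nat.cast_mul,
      ZMod.natCast_eq_zero_iff]
    have hr : p ^ r = p ^ (r - 1) * p := by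
      rw [← pow_succ, Nat.sub_add_cancel (Nat.pos_of_ne_zero (NeZero.ne r))]
    rw [hr]
    exact Nat.mul_dvd_mul_iff_left (pow_pos (Fact.out : p.Prime).pos _)

end ZModReduction

end ConvCode

end

/-! ### Invariance of the residual structural polynomial and the criterion. -/

theorem mainTheorem3 (p r k n : ℕ) [Fact p.Prime] [NeZero r]
    (C : Submodule (LaurentSeries (ZMod (p ^ r))) (Fin n → LaurentSeries (ZMod (p ^ r))))
    (hC : ConvCode.IsFreeConvCode k C) :
    (∀ G : Matrix (Fin k) (Fin n) (Polynomial (ZMod (p ^ r))),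
      ConvCode.IsRIDM G → ConvCode.code G = C →
        ConvCode.codeDelta hC = ConvCode.matrixDelta G) ∧
    (ConvCode.NonCatastrophicCode k C ↔
      ∃ s : ℕ, ConvCode.codeDelta hC = (Polynomial.X : Polynomial (ZMod p)) ^ s) ∧
    ((∃ Q : Polynomial (ZMod p), Irreducible Q ∧ ¬ Associated Q Polynomial.X ∧
        Q ∣ ConvCode.codeDelta hC) →
      ∀ G : Matrix (Fin k) (Fin n) (Polynomial (ZMod (p ^ r))),
        ConvCode.IsEncoder C G → ¬ ConvCode.NonCatastrophic G) := by
  have h := ConvCode.isReduction_zmod p r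
  obtain ⟨G₀, hG₀⟩ := hC
  obtain ⟨E, hE, hbasic⟩ := h.exists_basic hG₀
  have hridm : ∀ G : Matrix (Fin k) (Fin n) (Polynomial (ZMod (p ^ r))),
      ConvCode.IsRIDM G → ConvCode.code G = C →
        ConvCode.matrixDelta G = ConvCode.matrixDelta E := by
    intro G hG hGC
    obtain ⟨T, hT⟩ := hbasic G ⟨hG.1, hGC⟩
    have hu := h.isUnit_det_of_isRIDM hG hGC hE hT
    change ConvCode.minorsGCD (ConvCode.reduceMatrix _ G) = _
    rw [hT]
    exact ConvCode.minorsGCD_mul_of_isUnit hu _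
  have hdelta : ConvCode.codeDelta ⟨G₀, hG₀⟩ = ConvCode.matrixDelta E := by
    have hspec := (ConvCode.IsFreeConvCode.exists_ridm ⟨G₀, hG₀⟩).choose_spec
    exact hridm _ hspec.1 hspec.2
  rw [hdelta]
  have hcat : ∀ Q : Polynomial (ZMod p), Irreducible Q → ¬ Associated Q Polynomial.X →
      Q ∣ ConvCode.matrixDelta E → ∀ G : Matrix (Fin k) (Fin n) (Polynomial (ZMod (p ^ r))),
        ConvCode.IsEncoder C G → ¬ ConvCode.NonCatastrophic G := by
    intro Q hQ hQX hQE G hG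
    obtain ⟨T, hT⟩ := hbasic G hG
    refine h.not_nonCatastrophic hQ hQX fun e => ?_
    rw [hT]
    exact hQE.trans ((ConvCode.minorsGCD_mul_dvd T _).trans (ConvCode.minorsGCD_dvd _ e))
  refine ⟨fun G hG hGC => (hridm G hG hGC).symm, ⟨?_, ?_⟩, ?_⟩
  · rintro ⟨G, hG, hGN⟩
    obtain ⟨e, he⟩ := h.exists_minor_ne_zero hE.1
    refine ConvCode.eq_X_pow_of_irreducible_dvd ?_ (ConvCode.normalize_minorsGCD _)
      fun Q hQ hQE => ?_
    · exact ne_zero_of_dvd_ne_zero he (ConvCode.minorsGCD_dvd _ e)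
    · by_contra hQX
      exact hcat Q hQ hQX hQE G hG hGN
  · rintro ⟨s, hs⟩
    -- The basic encoder itself is the witness; it need not be a RIDM.
    exact ⟨E, hE, h.nonCatastrophic hs⟩
  · rintro ⟨Q, hQ, hQX, hQE⟩
    exact hcat Q hQ hQX hQE
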